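/- Let $\mathbb{T}=\mathbb{R}/\mathbb{Z}$ be the unit ring, and for $u,x\in\mathbb{T}$ let $d(u,x)\in[0,1)$ be the distance travelled from $u$ in the positive direction until $x$ is reached. In multi-probe consistent hashing, $n$ nodes are placed at points $x_1,\dots,x_n\in\mathbb{T}$; a key with hashes $u_1,\dots,u_K\in\mathbb{T}$ is assigned to the node $i$ for which $\min_{j} d(u_j,x_i)$ is smallest (ties, which have probability zero, are broken in favour of the smallest label). For fixed node positions, the load $L_i$ of node $i$ is the probability that a key whose $K$ hashes are independent and uniform on $\mathbb{T}$ is assigned to node $i$; the peak load is $\max_i L_i$ and the average load is $\frac1n\sum_i L_i$. Let the node hash function be random, that is, let $x_1,\dots,x_n$ be independent and uniformly distributed on $\mathbb{T}$. There is a constant $c>0$ such that for every sequence of integers $K=K(n)$ with $K(n)\ge 2$ for all large $n$ and $K(n)=o\!\left(\frac{\sqrt n}{\ln n}\right)$ there is a deterministic sequence $\varepsilon_n\to0$ such that, for all sufficiently large $n$, with probability at least $1-n^{-c}$ over the node positions, $$\left|\max_i L_i-\frac{K}{K-1}\cdot\frac1n\right|\le\frac{\varepsilon_n}{n} \qquad\text{and}\qquad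 \left|\frac{\max_i L_i}{\frac1n\sum_i L_i}-\frac{K}{K-1}\right|\le\varepsilon_n .$$ In other words, with high probability the peak load is $\frac{K}{K-1}\frac1n+o\!\left(\frac1n\right)$ and the peak-to-average load ratio is $\frac{K}{K-1}+o(1)$. -/

import Mathlib

namespace MultiProbe

open MeasureTheory ProbabilityTheory

/-- Distance on the unit ring `ℝ/ℤ` travelled from `u` in the positive direction until `x` is
reached: the representative of `x - u` in `[0, 1)`. -/
noncomputable def forwardDist (u x : UnitAddCircle) : ℝ :=
  (AddCircle.equivIco (1 : ℝ) 0 (x - u) : ℝ)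

/-- Node `i` (with the nodes at positions `x`) lies closest after one of the key hashes `u`:
some key hash reaches node `i` within the least distance from any key hash forward to any node. -/
def IsClosest {n K : ℕ} (x : Fin n → UnitAddCircle) (u : Fin K → UnitAddCircle) (i : Fin n) :
    Prop :=
  ∃ j : Fin K, ∀ (j' : Fin K) (i' : Fin n), forwardDist (u j) (x i) ≤ forwardDist (u j') (x i')

/-- A key with hashes `u` is assigned to node `i`: the closest node, ties (which have probability
zero) being broken in favour of the smallest label. -/
def IsAssigned {n K : ℕ} (x : Fin n → UnitAddCircle) (u : Fin K → UnitAddCircle) (i : Fin n) :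
    Prop :=
  IsClosest x u i ∧ ∀ i' < i, ¬ IsClosest x u i'

/-- The load on node `i` for fixed node positions `x`: the probability that a key whose `K` hashes
are independent and uniform on the unit ring is assigned to node `i`. -/
noncomputable def load {n : ℕ} (K : ℕ) (x : Fin n → UnitAddCircle) (i : Fin n) : ℝ :=
  (volume : Measure (Fin K → UnitAddCircle)).real {u | IsAssigned x u i}

/-- The maximum load over all nodes. -/
noncomputable def peakLoad {n : ℕ} (K : ℕ) (x : Fin n → UnitAddCircle) : ℝ :=
  ⨆ i : Fin n, load K x i

/-- The average load over all nodes. -/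
noncomputable def averageLoad {n : ℕ} (K : ℕ) (x : Fin n → UnitAddCircle) : ℝ :=
  (∑ i : Fin n, load K x i) / n

/-- A random hash function from the nodes to the unit ring: the hashes of the nodes are
independent, each with the uniform distribution on the ring. -/
structure IsRandomNodeHash {Ω : Type*} [MeasurableSpace Ω] (P : Measure Ω) {n : ℕ}
    (h : Fin n → Ω → UnitAddCircle) : Prop where
  measurable : ∀ i, Measurable (h i)
  uniform : ∀ i, P.map (h i) = volume
  indep : iIndepFun h P

end MultiProbe

namespace MultiProbe

open MeasureTheory ProbabilityTheory

/-! ### The forward distance -/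

/-! For fixed nodes let F(t) be the measure of the points with no node within distance t ahead. If
hash `j` is the first to reach a node and that node is `i`, then `u j` reaches `x i` at a uniform
distance t and the other K-1 hashes see no node within t. Hence every load is at most K ∫ F^(K-1),
and a node with the longest arc before it attains this bound: whenever another hash is farther than
t from all nodes, that arc is longer than t, so nothing separates `u j` from `x i`. Thus the peak
load is exactly K ∫ F^(K-1) (`peakLoad_eq`).

For random nodes F(t) has mean g(t) = (1-t)^n and variance at most n t² g(t). Replacing F by g would
give K/(n(K-1)+1), which is K/((K-1)n) up to O(1/n²). With K = k+2, the replacement error is at most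
(k+1) ∫ |F-g| max(F,g)^k. The power of the maximum must supply decay in k, so that the estimate is
uniform in K. Since 1-F is subadditive, the single event F(1/n) ≤ 1/2 forces F(t) ≤ exp(-nt/4) for t
≤ 1/n and F ≤ 1/2 beyond (`uncovered_le_exp`). With this weight the error in n times the peak load
has mean O(n^(-1/2)) (`integral_deviation_le`), and Markov's inequality concludes. -/

lemma forwardDist_nonneg (u x : UnitAddCircle) : 0 ≤ forwardDist u x :=
  (AddCircle.equivIco (1 : ℝ) 0 (x - u)).2.1

lemma forwardDist_lt_one (u x : UnitAddCircle) : forwardDist u x < 1 :=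
  (AddCircle.equivIco (1 : ℝ) 0 (x - u)).2.2.trans_eq (zero_add 1)

lemma coe_forwardDist (u x : UnitAddCircle) : (forwardDist u x : UnitAddCircle) = x - u :=
  AddCircle.coe_equivIco

lemma forwardDist_eq_of_coe_eq {u x : UnitAddCircle} {y : ℝ} (h0 : 0 ≤ y) (h1 : y < 1)
    (h : (y : UnitAddCircle) = x - u) : forwardDist u x = y := by
  unfold forwardDist
  rw [← h]
  exact AddCircle.equivIco_coe_of_mem (by simpa using And.intro h0 h1)

lemma eq_of_forwardDist_eq {u x y : UnitAddCircle} (h : forwardDist u x = forwardDist u y) :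
    x = y := by
  have := congrArg (fun r : ℝ => (r : UnitAddCircle)) h
  simpa [coe_forwardDist] using this

/-- Equality holds unless the two steps together go once around the ring, in which case the right
side is at least 1. -/
lemma forwardDist_triangle (w v x : UnitAddCircle) :
    forwardDist w x ≤ forwardDist w v + forwardDist v x := by
  by_cases h : forwardDist w v + forwardDist v x < 1
  · refine (forwardDist_eq_of_coe_eq ?_ h ?_).le
    · exact add_nonneg (forwardDist_nonneg _ _) (forwardDist_nonneg _ _)
    · rw [AddCircle.coe_add, coe_forwardDist, coe_forwardDist]; abel
  · exact (forwardDist_lt_one w x).le.trans (not_lt.1 h)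

lemma forwardDist_sub {w v x : UnitAddCircle} (h : forwardDist v x ≤ forwardDist w x) :
    forwardDist w v = forwardDist w x - forwardDist v x := by
  refine forwardDist_eq_of_coe_eq (sub_nonneg.2 h) ?_ ?_
  · linarith [forwardDist_lt_one w x, forwardDist_nonneg v x]
  · rw [AddCircle.coe_sub, coe_forwardDist, coe_forwardDist]; abel

lemma forwardDist_coe_add {w x : UnitAddCircle} {s : ℝ} (hs : 0 ≤ s) (h : s ≤ forwardDist w x) :
    forwardDist ((s : UnitAddCircle) + w) x = forwardDist w x - s := by
  refine forwardDist_eq_of_coe_eq (sub_nonneg.2 h) ?_ ?_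
  · linarith [forwardDist_lt_one w x]
  · rw [AddCircle.coe_sub, coe_forwardDist]; abel

lemma measurable_equivIco_val :
    Measurable fun z : UnitAddCircle => (AddCircle.equivIco (1 : ℝ) 0 z : ℝ) :=
  measurable_subtype_coe.comp (AddCircle.measurableEquivIco (1 : ℝ) 0).measurable

lemma Measurable.forwardDist {α : Type*} [MeasurableSpace α] {f g : α → UnitAddCircle}
    (hf : Measurable f) (hg : Measurable g) :
    Measurable fun a => MultiProbe.forwardDist (f a) (g a) :=
  measurable_equivIco_val.comp (hg.sub hf)

/-- On the open interval the representative map inverts the quotient map, and the endpoint is null.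
-/
lemma measurePreserving_equivIco_val :
    MeasurePreserving (fun z : UnitAddCircle => (AddCircle.equivIco (1 : ℝ) 0 z : ℝ)) volume
      (volume.restrict (Set.Ioo 0 1)) := by
  have h := AddCircle.measurePreserving_mk (1 : ℝ) 0
  rw [zero_add, ← Measure.restrict_congr_set Ioo_ae_eq_Ioc] at h
  refine ⟨measurable_equivIco_val, ?_⟩
  rw [← h.map_eq, Measure.map_map measurable_equivIco_val h.measurable]
  conv_rhs => rw [← Measure.map_id (μ := volume.restrict (Set.Ioo (0 : ℝ) 1))]
  refine Measure.map_congr ?_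
  refine (ae_restrict_iff' measurableSet_Ioo).2 (ae_of_all _ fun t ht => ?_)
  exact AddCircle.equivIco_coe_of_mem (by simpa using And.intro ht.1.le ht.2)

lemma measurePreserving_forwardDist_right (u : UnitAddCircle) :
    MeasurePreserving (fun x => forwardDist u x) volume (volume.restrict (Set.Ioo 0 1)) :=
  measurePreserving_equivIco_val.comp (measurePreserving_sub_right volume u)

lemma measurePreserving_forwardDist_left (x : UnitAddCircle) :
    MeasurePreserving (fun u => forwardDist u x) volume (volume.restrict (Set.Ioo 0 1)) :=
  measurePreserving_equivIco_val.comp (Measure.measurePreserving_sub_left volume x)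

instance isProbabilityMeasure_unitAddCircle :
    IsProbabilityMeasure (volume : Measure UnitAddCircle) :=
  ⟨by simp⟩

/-! ### The part of the ring at distance more than `t` before all nodes -/

/-- The measure of the set of points of the ring from which no node is reached within `t`. -/
noncomputable def uncovered {n : ℕ} (x : Fin n → UnitAddCircle) (t : ℝ) : ℝ :=
  (volume : Measure UnitAddCircle).real {w | ∀ i, t < forwardDist w (x i)}

lemma measurableSet_uncovered {n : ℕ} :
    MeasurableSet {p : ((Fin n → UnitAddCircle) × ℝ) × UnitAddCircle |
      ∀ i, p.1.2 < forwardDist p.2 (p.1.1 i)} := by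
  rw [Set.ofPred_forall]
  refine MeasurableSet.iInter fun i => measurableSet_lt (by fun_prop) ?_
  exact Measurable.forwardDist (by fun_prop) (by fun_prop)

lemma measurable_uncovered_uncurry {n : ℕ} :
    Measurable (Function.uncurry (uncovered (n := n))) :=
  (measurable_measure_prodMk_left measurableSet_uncovered).ennreal_toReal

lemma measurable_uncovered {n : ℕ} (x : Fin n → UnitAddCircle) : Measurable (uncovered x) :=
  Measurable.of_uncurry_left (f := uncovered) measurable_uncovered_uncurry

lemma measurable_uncovered_left {n : ℕ} (t : ℝ) :
    Measurable fun x : Fin n → UnitAddCircle => uncovered x t :=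
  Measurable.of_uncurry_right (f := uncovered) measurable_uncovered_uncurry

lemma uncovered_nonneg {n : ℕ} (x : Fin n → UnitAddCircle) (t : ℝ) : 0 ≤ uncovered x t :=
  measureReal_nonneg

lemma uncovered_le_one {n : ℕ} (x : Fin n → UnitAddCircle) (t : ℝ) : uncovered x t ≤ 1 :=
  measureReal_le_one

lemma uncovered_antitone {n : ℕ} (x : Fin n → UnitAddCircle) : Antitone (uncovered x) :=
  fun _ _ h => measureReal_mono fun _ hw i => h.trans_lt (hw i)

lemma measurableSet_lt_forwardDist {n : ℕ} (x : Fin n → UnitAddCircle) (t : ℝ) :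
    MeasurableSet {w | ∀ i, t < forwardDist w (x i)} := by
  rw [Set.ofPred_forall]
  exact MeasurableSet.iInter fun i =>
    measurableSet_lt measurable_const (Measurable.forwardDist measurable_id measurable_const)

/-- The part of the ring within `t` before a node has measure subadditive in `t`. -/
lemma uncovered_add_le {n : ℕ} (x : Fin n → UnitAddCircle) {s : ℝ} (hs : 0 ≤ s) (t : ℝ) :
    uncovered x s + uncovered x t ≤ 1 + uncovered x (s + t) := by
  set A := {w | ∀ i, s < forwardDist w (x i)}
  set B := {w | ∀ i, t < forwardDist w (x i)}
  -- `B'` is `B` moved back by `s`. A point of `A` meets no node while moving forward by `s`, so if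
  -- it also lies in `B'` it is more than `s + t` before every node.
  set B' := (fun w => (s : UnitAddCircle) + w) ⁻¹' B
  have hB : volume.real B' = volume.real B := by
    simp only [measureReal_def, B']
    rw [measure_preimage_add]
  have hBm : MeasurableSet B' :=
    (measurableSet_lt_forwardDist x t).preimage (measurable_const_add _)
  have h1 := measureReal_union_add_inter (μ := (volume : Measure UnitAddCircle)) (s := A) hBm
  have h2 : volume.real (A ∪ B') ≤ 1 := measureReal_le_one
  have h3 : volume.real (A ∩ B') ≤ uncovered x (s + t) := by
    refine measureReal_mono fun w hw i => ?_
    have h := hw.2 i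
    rw [forwardDist_coe_add hs (hw.1 i).le] at h
    linarith
  change volume.real A + volume.real B ≤ _
  linarith

lemma mul_one_sub_uncovered_ge {n : ℕ} (x : Fin n → UnitAddCircle) {t : ℝ} (ht : 0 ≤ t) (N : ℕ) :
    1 - uncovered x ((N + 1 : ℕ) * t) ≤ (N + 1 : ℕ) * (1 - uncovered x t) := by
  induction N with
  | zero => simp
  | succ N ih =>
    have h := uncovered_add_le x ht ((N + 1 : ℕ) * t)
    have e : t + ((N + 1 : ℕ) : ℝ) * t = ((N + 1 + 1 : ℕ) : ℝ) * t := by push_cast; ring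
    rw [e] at h
    push_cast at *
    linarith

/-- By subadditivity, the half of the ring covered within 1/n forces a proportional share, at least
nt/4, to be covered already within t. -/
lemma uncovered_le_exp {n : ℕ} (hn : 0 < n) (x : Fin n → UnitAddCircle)
    (hx : uncovered x (1 / n) ≤ 1 / 2) {t : ℝ} (ht : 0 ≤ t) (htn : t ≤ 1 / n) :
    uncovered x t ≤ Real.exp (-(n * t / 4)) := by
  rcases ht.eq_or_lt with rfl | ht0
  · simpa using uncovered_le_one x 0
  have hn' : (0 : ℝ) < n := by exact_mod_cast hn
  have hnt : 0 < n * t := by positivity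
  have hnt1 : n * t ≤ 1 := by rwa [le_div_iff₀ hn', mul_comm] at htn
  -- N+1 steps of length t pass 1/n, yet (N+1)nt ≤ 1 + nt ≤ 2. This factor 2 and the 1/2 in the
  -- hypothesis make the constant 1/4.
  set N := ⌊1 / (n * t)⌋₊
  have hN1 : 1 / (n * t) < N + 1 := Nat.lt_floor_add_one _
  have hN2 : (N : ℝ) ≤ 1 / (n * t) := Nat.floor_le (by positivity)
  have h := mul_one_sub_uncovered_ge x ht N
  rw [div_lt_iff₀ hnt] at hN1
  rw [le_div_iff₀ hnt] at hN2
  have hmono : uncovered x ((N + 1 : ℕ) * t) ≤ uncovered x (1 / n) := by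
    refine uncovered_antitone x ?_
    rw [div_le_iff₀ hn']
    push_cast
    linarith
  have hkey : n * t / 4 ≤ 1 - uncovered x t := by
    have hF : 0 ≤ 1 - uncovered x t := by linarith [uncovered_le_one x t]
    have h1 : (1 / 2 : ℝ) ≤ (N + 1) * (1 - uncovered x t) := by
      push_cast at h hmono
      linarith
    have h2 : (N + 1 : ℝ) * (n * t) ≤ 2 := by linarith
    nlinarith [mul_le_mul_of_nonneg_right h2 hF, mul_le_mul_of_nonneg_right h1 hnt.le]
  linarith [Real.add_one_le_exp (-(n * t / 4))]

/-! ### The load of a node -/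

/-- Condition on coordinate `j`; the other `m` coordinates are then independent. -/
lemma volume_forall_succAbove {m : ℕ} (j : Fin (m + 1)) {S : Set (UnitAddCircle × UnitAddCircle)}
    (hS : MeasurableSet S) :
    volume {u : Fin (m + 1) → UnitAddCircle | ∀ k : Fin m, (u j, u (j.succAbove k)) ∈ S} =
      ∫⁻ v : UnitAddCircle, volume {w | (v, w) ∈ S} ^ m := by
  have hmp := volume_preserving_piFinSuccAbove (fun _ : Fin (m + 1) => UnitAddCircle) j
  set S' : Set (UnitAddCircle × (Fin m → UnitAddCircle)) := {p | ∀ k, (p.1, p.2 k) ∈ S}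
  have hS' : MeasurableSet S' := by
    simp only [S', Set.ofPred_forall]
    exact MeasurableSet.iInter fun k => hS.preimage (by fun_prop)
  have h1 := hmp.measure_preimage hS'.nullMeasurableSet
  have h2 : (MeasurableEquiv.piFinSuccAbove (fun _ : Fin (m + 1) => UnitAddCircle) j) ⁻¹' S' =
      {u | ∀ k : Fin m, (u j, u (j.succAbove k)) ∈ S} := rfl
  rw [← h2, h1, Measure.volume_eq_prod, Measure.prod_apply hS']
  refine lintegral_congr fun v => ?_
  have h3 : Prod.mk v ⁻¹' S' = Set.univ.pi fun _ : Fin m => {w | (v, w) ∈ S} := by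
    ext f; simp [S']
  rw [h3, volume_pi_pi]
  simp

lemma lintegral_forwardDist {f : ℝ → ENNReal} (hf : Measurable f) (x : UnitAddCircle) :
    ∫⁻ v, f (forwardDist v x) = ∫⁻ t in Set.Ioo 0 1, f t :=
  (measurePreserving_forwardDist_left x).lintegral_comp hf

lemma ofReal_uncovered {n : ℕ} (x : Fin n → UnitAddCircle) (t : ℝ) :
    ENNReal.ofReal (uncovered x t) = volume {w | ∀ i, t < forwardDist w (x i)} :=
  ofReal_measureReal

lemma volume_forwardDist_eq (x : UnitAddCircle) (t : ℝ) :
    volume {w | forwardDist w x = t} = 0 := by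
  have h := (measurePreserving_forwardDist_left x).measure_preimage
    (measurableSet_singleton t).nullMeasurableSet
  have h0 : (volume.restrict (Set.Ioo (0 : ℝ) 1)) {t} = 0 := measure_singleton t
  rw [h0] at h
  exact h

/-- Ties are null because the distance to a fixed node is uniform. The bounds of the load from above
(weak inequalities) and below (strict ones) therefore agree. -/
lemma volume_forall_le_forwardDist {n : ℕ} (x : Fin n → UnitAddCircle) (t : ℝ) :
    volume {w | ∀ i, t ≤ forwardDist w (x i)} = ENNReal.ofReal (uncovered x t) := by
  rw [ofReal_uncovered]
  refine le_antisymm ?_ (measure_mono fun w hw i => (hw i).le)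
  calc volume {w | ∀ i, t ≤ forwardDist w (x i)}
      ≤ volume ({w | ∀ i, t < forwardDist w (x i)} ∪ ⋃ i, {w | forwardDist w (x i) = t}) := by
        refine measure_mono fun w hw => ?_
        by_cases h : ∃ i, forwardDist w (x i) = t
        · exact Or.inr (by simpa using h)
        · push Not at h
          exact Or.inl fun i => lt_of_le_of_ne (hw i) (h i).symm
    _ ≤ volume {w | ∀ i, t < forwardDist w (x i)} + 0 := by
        refine (measure_union_le _ _).trans (add_le_add le_rfl ?_)
        exact (measure_iUnion_null fun i => volume_forwardDist_eq (x i) t).le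
    _ = _ := add_zero _

lemma lintegral_uncovered_pow {n : ℕ} (x : Fin n → UnitAddCircle) (m : ℕ) :
    ∫⁻ t in Set.Ioo (0 : ℝ) 1, ENNReal.ofReal (uncovered x t) ^ m =
      ENNReal.ofReal (∫ t in (0 : ℝ)..1, uncovered x t ^ m) := by
  rw [intervalIntegral.integral_of_le zero_le_one, integral_Ioc_eq_integral_Ioo,
    ofReal_integral_eq_lintegral_ofReal]
  · simp only [ENNReal.ofReal_pow (uncovered_nonneg x _)]
  · refine Integrable.of_bound ((measurable_uncovered x).pow_const m).aestronglyMeasurable 1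
      (ae_of_all _ fun t => ?_)
    rw [Real.norm_of_nonneg (pow_nonneg (uncovered_nonneg x t) m)]
    exact pow_le_one₀ (uncovered_nonneg x t) (uncovered_le_one x t)
  · exact ae_of_all _ fun t => pow_nonneg (uncovered_nonneg x t) m

lemma volume_forall_le_forwardDist_node {n m : ℕ} (x : Fin n → UnitAddCircle) (i : Fin n)
    (j : Fin (m + 1)) :
    volume {u : Fin (m + 1) → UnitAddCircle |
      ∀ k i', forwardDist (u j) (x i) ≤ forwardDist (u (j.succAbove k)) (x i')} =
      ENNReal.ofReal (∫ t in (0 : ℝ)..1, uncovered x t ^ m) := by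
  have hS : MeasurableSet {p : UnitAddCircle × UnitAddCircle |
      ∀ i', forwardDist p.1 (x i) ≤ forwardDist p.2 (x i')} := by
    rw [Set.ofPred_forall]
    exact MeasurableSet.iInter fun i' => measurableSet_le
      (Measurable.forwardDist measurable_fst measurable_const)
      (Measurable.forwardDist measurable_snd measurable_const)
  refine (volume_forall_succAbove j hS).trans ?_
  simp only [Set.mem_ofPred_eq, volume_forall_le_forwardDist]
  rw [lintegral_forwardDist (f := fun t => ENNReal.ofReal (uncovered x t) ^ m)
    ((measurable_uncovered x).ennreal_ofReal.pow_const m), lintegral_uncovered_pow]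

lemma measurableSet_lt_forwardDist_node {n m : ℕ} (x : Fin n → UnitAddCircle) (i : Fin n)
    (j : Fin (m + 1)) :
    MeasurableSet {u : Fin (m + 1) → UnitAddCircle |
      ∀ k i', forwardDist (u j) (x i) < forwardDist (u (j.succAbove k)) (x i')} := by
  simp only [Set.ofPred_forall]
  exact MeasurableSet.iInter fun k => MeasurableSet.iInter fun i' => measurableSet_lt
    (Measurable.forwardDist (by fun_prop) measurable_const)
    (Measurable.forwardDist (by fun_prop) measurable_const)

lemma volume_forall_lt_forwardDist_node {n m : ℕ} (x : Fin n → UnitAddCircle) (i : Fin n)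
    (j : Fin (m + 1)) :
    volume {u : Fin (m + 1) → UnitAddCircle |
      ∀ k i', forwardDist (u j) (x i) < forwardDist (u (j.succAbove k)) (x i')} =
      ENNReal.ofReal (∫ t in (0 : ℝ)..1, uncovered x t ^ m) := by
  have hS : MeasurableSet {p : UnitAddCircle × UnitAddCircle |
      ∀ i', forwardDist p.1 (x i) < forwardDist p.2 (x i')} := by
    rw [Set.ofPred_forall]
    exact MeasurableSet.iInter fun i' => measurableSet_lt
      (Measurable.forwardDist measurable_fst measurable_const)
      (Measurable.forwardDist measurable_snd measurable_const)
  refine (volume_forall_succAbove j hS).trans ?_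
  simp only [Set.mem_ofPred_eq, ← ofReal_uncovered]
  rw [lintegral_forwardDist (f := fun t => ENNReal.ofReal (uncovered x t) ^ m)
    ((measurable_uncovered x).ennreal_ofReal.pow_const m), lintegral_uncovered_pow]

/-- Union bound over the hash that reaches the node first, dropping the requirement that no other
node lies in between. -/
lemma load_le {n m : ℕ} (x : Fin n → UnitAddCircle) (i : Fin n) :
    load (m + 1) x i ≤ (m + 1) * ∫ t in (0 : ℝ)..1, uncovered x t ^ m := by
  have hI : 0 ≤ ∫ t in (0 : ℝ)..1, uncovered x t ^ m :=
    intervalIntegral.integral_nonneg zero_le_one fun t _ => pow_nonneg (uncovered_nonneg x t) m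
  refine ENNReal.toReal_le_of_le_ofReal (by positivity) ?_
  calc volume {u : Fin (m + 1) → UnitAddCircle | IsAssigned x u i}
      ≤ volume (⋃ j : Fin (m + 1), {u : Fin (m + 1) → UnitAddCircle |
          ∀ k i', forwardDist (u j) (x i) ≤ forwardDist (u (j.succAbove k)) (x i')}) := by
        refine measure_mono fun u hu => ?_
        obtain ⟨j, hj⟩ := hu.1
        exact Set.mem_iUnion.2 ⟨j, fun k i' => hj _ i'⟩
    _ ≤ ∑ j : Fin (m + 1), volume {u : Fin (m + 1) → UnitAddCircle |
          ∀ k i', forwardDist (u j) (x i) ≤ forwardDist (u (j.succAbove k)) (x i')} :=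
        measure_iUnion_fintype_le _ _
    _ = _ := by
        simp only [volume_forall_le_forwardDist_node]
        rw [ENNReal.ofReal_mul (by positivity)]
        simp [ENNReal.ofReal_add]

/-- Some node has the longest arc before it; among the nodes at its position it may be taken to
have the smallest label. -/
lemma exists_node_longest_arc {n : ℕ} (hn : 0 < n) (x : Fin n → UnitAddCircle) :
    ∃ i : Fin n, (∀ (t : ℝ) (w : UnitAddCircle), (∀ i', t < forwardDist w (x i')) →
        ∃ w', t < forwardDist w' (x i) ∧ ∀ i', forwardDist w' (x i) ≤ forwardDist w' (x i')) ∧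
      ∀ i' < i, x i' ≠ x i := by
  have : Nonempty (Fin n) := ⟨⟨0, hn⟩⟩
  set Q : Fin n → Prop := fun i => ∀ (t : ℝ) (w : UnitAddCircle),
    (∀ i', t < forwardDist w (x i')) →
      ∃ w', t < forwardDist w' (x i) ∧ ∀ i', forwardDist w' (x i) ≤ forwardDist w' (x i') with hQ
  have hex : {i | Q i}.Nonempty := by
    by_contra hne
    rw [Set.not_nonempty_iff_eq_empty, Set.eq_empty_iff_forall_notMem] at hne
    simp only [hQ, Set.mem_ofPred_eq] at hne
    push Not at hne
    choose t w hw hnext using hne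
    -- Take the failing witness with the largest `t`. The first node `i₀` after its point has an arc
    -- longer than `t i ≥ t i₀`, so `i₀` cannot fail.
    obtain ⟨i, hi⟩ := Finite.exists_max t
    obtain ⟨i₀, hi₀⟩ := Finite.exists_min fun i' => forwardDist (w i) (x i')
    obtain ⟨i', hi'⟩ := hnext i₀ (w i) ((hi i₀).trans_lt (hw i i₀))
    exact absurd hi' (not_lt.2 (hi₀ i'))
  obtain ⟨i, hi, hmin⟩ := WellFounded.has_min (wellFounded_lt (α := Fin n)) _ hex
  refine ⟨i, hi, fun i' hlt heq => hmin i' ?_ hlt⟩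
  simp only [hQ, Set.mem_ofPred_eq] at hi ⊢
  rwa [heq]

/-- For a node with the longest arc, the union bound of `load_le` loses nothing: the strict events
are disjoint and each already implies assignment to that node. -/
lemma exists_load_ge {n m : ℕ} (hn : 0 < n) (hm : 0 < m) (x : Fin n → UnitAddCircle) :
    ∃ i, (m + 1) * ∫ t in (0 : ℝ)..1, uncovered x t ^ m ≤ load (m + 1) x i := by
  obtain ⟨i, hi, hmin⟩ := exists_node_longest_arc hn x
  refine ⟨i, ?_⟩
  set A : Fin (m + 1) → Set (Fin (m + 1) → UnitAddCircle) := fun j =>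
    {u | ∀ k i', forwardDist (u j) (x i) < forwardDist (u (j.succAbove k)) (x i')} with hA
  have hlt : ∀ {j j' : Fin (m + 1)} {u}, u ∈ A j → j' ≠ j → ∀ i',
      forwardDist (u j) (x i) < forwardDist (u j') (x i') := by
    intro j j' u hu hne i'
    obtain ⟨k, rfl⟩ := Fin.exists_succAbove_eq hne
    exact hu k i'
  have hdisj : Pairwise (Function.onFun Disjoint A) := by
    intro j j' hne
    refine Set.disjoint_left.2 fun u hu hu' => ?_
    exact lt_asymm (hlt hu hne.symm i) (hlt hu' hne i)
  have hsub : (⋃ j, A j) ⊆ {u | IsAssigned x u i} := by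
    intro u hu
    obtain ⟨j, hj⟩ := Set.mem_iUnion.1 hu
    -- A second hash, available since `0 < m`, witnesses that the arc before `x i` is longer than
    -- the distance from `u j`; so `u j` lies in that arc.
    obtain ⟨w, hw, hw'⟩ := hi _ _ (hj ⟨0, hm⟩)
    have hcl : ∀ i', forwardDist (u j) (x i) ≤ forwardDist (u j) (x i') := by
      intro i'
      have h1 := forwardDist_sub hw.le
      have h2 := forwardDist_triangle w (u j) (x i')
      linarith [hw' i']
    refine ⟨⟨j, fun j' i' => ?_⟩, ?_⟩
    · by_cases h : j' = j
      · rw [h]; exact hcl i'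
      · exact (hlt hj h i').le
    · rintro i' hlt' ⟨j', hj'⟩
      have h1 := hj' j i
      by_cases h : j' = j
      · rw [h] at h1
        exact hmin i' hlt' (eq_of_forwardDist_eq (le_antisymm h1 (hcl i')))
      · exact absurd h1 (not_le.2 (hlt hj h i'))
  have hI : 0 ≤ ∫ t in (0 : ℝ)..1, uncovered x t ^ m :=
    intervalIntegral.integral_nonneg zero_le_one fun t _ => pow_nonneg (uncovered_nonneg x t) m
  have hvol : volume (⋃ j, A j) =
      ENNReal.ofReal ((m + 1) * ∫ t in (0 : ℝ)..1, uncovered x t ^ m) := by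
    rw [measure_iUnion hdisj fun j => measurableSet_lt_forwardDist_node x i j, tsum_fintype]
    simp only [hA, volume_forall_lt_forwardDist_node]
    rw [ENNReal.ofReal_mul (by positivity)]
    simp [ENNReal.ofReal_add]
  refine (ENNReal.ofReal_le_iff_le_toReal (measure_ne_top _ _)).1 ?_
  rw [← hvol]
  exact measure_mono hsub

/-- The peak load is the load of a node with the longest arc before it. -/
lemma peakLoad_eq {n m : ℕ} (hn : 0 < n) (hm : 0 < m) (x : Fin n → UnitAddCircle) :
    peakLoad (m + 1) x = (m + 1) * ∫ t in (0 : ℝ)..1, uncovered x t ^ m := by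
  have : Nonempty (Fin n) := ⟨⟨0, hn⟩⟩
  obtain ⟨i, hi⟩ := exists_load_ge hn hm x
  exact le_antisymm (ciSup_le fun i => load_le x i)
    (hi.trans (le_ciSup (Set.finite_range _).bddAbove i))

/-! ### The average load. -/

lemma measurableSet_isClosest {n K : ℕ} (x : Fin n → UnitAddCircle) (i : Fin n) :
    MeasurableSet {u : Fin K → UnitAddCircle | IsClosest x u i} := by
  simp only [IsClosest, Set.ofPred_exists, Set.ofPred_forall]
  exact MeasurableSet.iUnion fun j => MeasurableSet.iInter fun j' => MeasurableSet.iInter fun i' =>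
    measurableSet_le (Measurable.forwardDist (by fun_prop) measurable_const)
      (Measurable.forwardDist (by fun_prop) measurable_const)

lemma measurableSet_isAssigned {n K : ℕ} (x : Fin n → UnitAddCircle) (i : Fin n) :
    MeasurableSet {u : Fin K → UnitAddCircle | IsAssigned x u i} := by
  simp only [IsAssigned, Set.ofPred_and, Set.ofPred_forall]
  exact (measurableSet_isClosest x i).inter (MeasurableSet.iInter fun i' =>
    MeasurableSet.iInter fun _ => (measurableSet_isClosest x i').compl)

lemma exists_isAssigned {n K : ℕ} (hn : 0 < n) (hK : 0 < K) (x : Fin n → UnitAddCircle)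
    (u : Fin K → UnitAddCircle) : ∃ i, IsAssigned x u i := by
  have : Nonempty (Fin n) := ⟨⟨0, hn⟩⟩
  have : Nonempty (Fin K) := ⟨⟨0, hK⟩⟩
  obtain ⟨p, hp⟩ := Finite.exists_min fun p : Fin K × Fin n => forwardDist (u p.1) (x p.2)
  have hne : {i | IsClosest x u i}.Nonempty := ⟨p.2, p.1, fun j' i' => hp (j', i')⟩
  obtain ⟨i, hi, hmin⟩ := WellFounded.has_min (wellFounded_lt (α := Fin n)) _ hne
  exact ⟨i, hi, fun i' hlt hi' => hmin i' hi' hlt⟩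

lemma sum_load {n K : ℕ} (hn : 0 < n) (hK : 0 < K) (x : Fin n → UnitAddCircle) :
    ∑ i, load K x i = 1 := by
  have hdisj : Pairwise (Function.onFun Disjoint
      fun i : Fin n => {u : Fin K → UnitAddCircle | IsAssigned x u i}) := by
    intro i i' hne
    refine Set.disjoint_left.2 fun u hu hu' => ?_
    rcases lt_or_gt_of_ne hne with h | h
    · exact hu'.2 i h hu.1
    · exact hu.2 i' h hu'.1
  have hU : (⋃ i : Fin n, {u : Fin K → UnitAddCircle | IsAssigned x u i}) = Set.univ :=
    Set.eq_univ_of_forall fun u => Set.mem_iUnion.2 (exists_isAssigned hn hK x u)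
  have h := measureReal_iUnion_fintype (μ := (volume : Measure (Fin K → UnitAddCircle))) hdisj
    fun i => measurableSet_isAssigned x i
  rw [hU, probReal_univ] at h
  exact h.symm

lemma averageLoad_eq {n K : ℕ} (hn : 0 < n) (hK : 0 < K) (x : Fin n → UnitAddCircle) :
    averageLoad K x = 1 / n := by
  rw [averageLoad, sum_load hn hK]

/-! ### Moments of the uncovered part for random nodes -/

/-- Tonelli and independence of the nodes. One point `a` of the ring gives the first moment of
`uncovered`, a pair of points the second. -/
lemma lintegral_volume_forall_mem {α : Type*} [MeasurableSpace α] (μ : Measure α) [SFinite μ]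
    {n : ℕ} {S : Set (α × UnitAddCircle)} (hS : MeasurableSet S) :
    ∫⁻ x : Fin n → UnitAddCircle, μ {a | ∀ i, (a, x i) ∈ S} =
      ∫⁻ a, volume {y | (a, y) ∈ S} ^ n ∂μ := by
  set S' : Set ((Fin n → UnitAddCircle) × α) := {p | ∀ i, (p.2, p.1 i) ∈ S}
  have hS' : MeasurableSet S' := by
    simp only [S', Set.ofPred_forall]
    exact MeasurableSet.iInter fun k => hS.preimage (by fun_prop)
  have h1 := Measure.prod_apply (μ := (volume : Measure (Fin n → UnitAddCircle))) (ν := μ) hS'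
  have h2 := Measure.prod_apply_symm (μ := (volume : Measure (Fin n → UnitAddCircle))) (ν := μ) hS'
  refine h1.symm.trans (h2.trans (lintegral_congr fun a => ?_))
  have h3 : (fun x => (x, a)) ⁻¹' S' = Set.univ.pi fun _ : Fin n => {y | (a, y) ∈ S} := by
    ext f; simp [S']
  rw [h3, volume_pi_pi]
  simp

lemma volume_lt_forwardDist_right (w : UnitAddCircle) {t : ℝ} (ht : 0 ≤ t) :
    volume {y | t < forwardDist w y} = ENNReal.ofReal (1 - t) := by
  have h := (measurePreserving_forwardDist_right w).measure_preimage
    (measurableSet_Ioi (a := t)).nullMeasurableSet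
  rw [Measure.restrict_apply measurableSet_Ioi] at h
  refine h.trans ?_
  have : Set.Ioi t ∩ Set.Ioo 0 1 = Set.Ioo t 1 := by
    ext y
    simp only [Set.mem_inter_iff, Set.mem_Ioi, Set.mem_Ioo]
    exact ⟨fun h => ⟨h.1, h.2.2⟩, fun h => ⟨h.1, ht.trans_lt h.1, h.2⟩⟩
  rw [this, Real.volume_Ioo]

lemma integrable_uncovered_pow {n : ℕ} (t : ℝ) (k : ℕ) :
    Integrable fun x : Fin n → UnitAddCircle => uncovered x t ^ k := by
  refine Integrable.of_bound ((measurable_uncovered_left t).pow_const k).aestronglyMeasurable 1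
    (ae_of_all _ fun x => ?_)
  rw [Real.norm_of_nonneg (pow_nonneg (uncovered_nonneg x t) k)]
  exact pow_le_one₀ (uncovered_nonneg x t) (uncovered_le_one x t)

lemma integral_uncovered {n : ℕ} {t : ℝ} (h0 : 0 ≤ t) (h1 : t ≤ 1) :
    ∫ x : Fin n → UnitAddCircle, uncovered x t = (1 - t) ^ n := by
  have hS : MeasurableSet {p : UnitAddCircle × UnitAddCircle | t < forwardDist p.1 p.2} :=
    measurableSet_lt measurable_const (Measurable.forwardDist measurable_fst measurable_snd)
  have h := lintegral_volume_forall_mem (n := n) volume hS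
  simp only [Set.mem_ofPred_eq, volume_lt_forwardDist_right _ h0, lintegral_const,
    measure_univ, mul_one] at h
  rw [integral_eq_lintegral_of_nonneg_ae (ae_of_all _ fun x => uncovered_nonneg x t)
    (measurable_uncovered_left t).aestronglyMeasurable]
  simp only [ofReal_uncovered]
  rw [h, ENNReal.toReal_pow, ENNReal.toReal_ofReal (sub_nonneg.2 h1)]

lemma forwardDist_sub_left {w v y : UnitAddCircle} (h : forwardDist w v ≤ forwardDist w y) :
    forwardDist v y = forwardDist w y - forwardDist w v := by
  refine forwardDist_eq_of_coe_eq (sub_nonneg.2 h) ?_ ?_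
  · linarith [forwardDist_lt_one w y, forwardDist_nonneg w v]
  · rw [AddCircle.coe_sub, coe_forwardDist, coe_forwardDist]; abel

lemma volume_lt_forwardDist_and_le (w v : UnitAddCircle) (t : ℝ) :
    volume {y | t < forwardDist w y ∧ t < forwardDist v y} ≤
      ENNReal.ofReal (max (forwardDist w v - t) 0 + max (1 - forwardDist w v - t) 0) := by
  set r := forwardDist w v
  -- Cut the ring at `w` and `v`: a node before `v` must avoid the first `t` after `w`, a node past
  -- `v` the first `t` after `v`.
  have hsub : {y | t < forwardDist w y ∧ t < forwardDist v y} ⊆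
      (fun y => forwardDist w y) ⁻¹' (Set.Ioo t r ∪ Set.Ioo (r + t) 1) := by
    rintro y ⟨hy1, hy2⟩
    rcases lt_or_ge (forwardDist w y) r with h | h
    · exact Or.inl ⟨hy1, h⟩
    · rw [forwardDist_sub_left h] at hy2
      exact Or.inr ⟨by linarith, forwardDist_lt_one w y⟩
  refine (measure_mono hsub).trans ?_
  rw [(measurePreserving_forwardDist_right w).measure_preimage
    (measurableSet_Ioo.union measurableSet_Ioo).nullMeasurableSet]
  refine (Measure.restrict_apply_le _ _).trans ((measure_union_le _ _).trans ?_)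
  rw [Real.volume_Ioo, Real.volume_Ioo, ENNReal.ofReal_add (le_max_right _ _) (le_max_right _ _)]
  refine add_le_add (ENNReal.ofReal_le_ofReal (le_max_left _ _))
    (ENNReal.ofReal_le_ofReal (le_max_of_le_left (by linarith)))

/-- Two points at distance at least t both ways are negatively correlated, as 1-2t ≤ (1-t)². Closer
pairs pay a correction linear in their overlap, which integrates over r to t². -/
lemma overlap_pow_le {t r : ℝ} (ht0 : 0 ≤ t) (ht1 : t ≤ 1) (hr0 : 0 ≤ r) (hr1 : r ≤ 1) (n : ℕ) :
    (max (r - t) 0 + max (1 - r - t) 0) ^ n ≤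
      (1 - t) ^ n * ((1 - t) ^ n + n * (max (t - r) 0 + max (t - (1 - r)) 0)) := by
  obtain ⟨s, hs0, hst, hs, hts⟩ : ∃ s, 0 ≤ s ∧ s ≤ t ∧
      max (r - t) 0 + max (1 - r - t) 0 ≤ (1 - t) * (1 - s) ∧
      t - s ≤ max (t - r) 0 + max (t - (1 - r)) 0 := by
    rcases le_total t r with h1 | h1 <;> rcases le_total t (1 - r) with h2 | h2
    · refine ⟨t, ht0, le_rfl, ?_, ?_⟩
      · rw [max_eq_left (by linarith), max_eq_left (by linarith)]; nlinarith
      · rw [sub_self]; positivity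
    · refine ⟨1 - r, by linarith, h2, ?_, ?_⟩
      · rw [max_eq_left (by linarith), max_eq_right (by linarith)]; nlinarith
      · linarith [le_max_right (t - r) 0, le_max_left (t - (1 - r)) 0]
    · refine ⟨r, hr0, h1, ?_, ?_⟩
      · rw [max_eq_right (by linarith), max_eq_left (by linarith)]; nlinarith
      · linarith [le_max_left (t - r) 0, le_max_right (t - (1 - r)) 0]
    · refine ⟨r, hr0, h1, ?_, ?_⟩
      · rw [max_eq_right (by linarith), max_eq_right (by linarith)]; nlinarith
      · linarith [le_max_left (t - r) 0, le_max_right (t - (1 - r)) 0]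
  refine (pow_le_pow_left₀ (by positivity) hs n).trans ?_
  rw [mul_pow]
  refine mul_le_mul_of_nonneg_left ?_ (pow_nonneg (by linarith) n)
  -- Mean value bound: (1-s)^n exceeds (1-t)^n by at most n(t-s).
  have h := abs_pow_sub_pow_le (1 - s) (1 - t) n
  rw [abs_of_nonneg (show 0 ≤ 1 - s - (1 - t) by linarith), abs_of_nonneg (by linarith : 0 ≤ 1 - s),
    abs_of_nonneg (by linarith : 0 ≤ 1 - t)] at h
  have hmax : max (1 - s) (1 - t) ^ (n - 1) ≤ 1 :=
    pow_le_one₀ (le_max_of_le_left (by linarith)) (max_le (by linarith) (by linarith))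
  have h2 : (1 - s - (1 - t)) * n * max (1 - s) (1 - t) ^ (n - 1) ≤ (t - s) * n := by
    refine (mul_le_of_le_one_right ?_ hmax).trans_eq (by ring)
    exact mul_nonneg (by linarith) (Nat.cast_nonneg n)
  have h3 : (t - s) * n ≤ n * (max (t - r) 0 + max (t - (1 - r)) 0) := by
    rw [mul_comm]
    exact mul_le_mul_of_nonneg_left hts (Nat.cast_nonneg n)
  linarith [le_abs_self ((1 - s) ^ n - (1 - t) ^ n)]

lemma integral_max_sub {t : ℝ} (ht0 : 0 ≤ t) (ht1 : t ≤ 1) :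
    ∫ r in (0 : ℝ)..1, max (t - r) 0 = t ^ 2 / 2 := by
  have hc : Continuous fun r : ℝ => max (t - r) 0 := by fun_prop
  rw [← intervalIntegral.integral_add_adjacent_intervals (hc.intervalIntegrable 0 t)
    (hc.intervalIntegrable t 1)]
  have h1 : ∫ r in (0 : ℝ)..t, max (t - r) 0 = ∫ r in (0 : ℝ)..t, (t - r) := by
    refine intervalIntegral.integral_congr fun r hr => ?_
    rw [Set.uIcc_of_le ht0] at hr
    exact max_eq_left (by linarith [hr.2])
  have h2 : ∫ r in t..1, max (t - r) 0 = ∫ r in t..1, (0 : ℝ) := by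
    refine intervalIntegral.integral_congr fun r hr => ?_
    rw [Set.uIcc_of_le ht1] at hr
    exact max_eq_right (by linarith [hr.1])
  rw [h1, h2, intervalIntegral.integral_sub (by simp) (by simp)]
  simp
  ring

lemma integral_max_sub_one_sub {t : ℝ} (ht0 : 0 ≤ t) (ht1 : t ≤ 1) :
    ∫ r in (0 : ℝ)..1, max (t - (1 - r)) 0 = t ^ 2 / 2 := by
  rw [intervalIntegral.integral_comp_sub_left (fun r => max (t - r) 0) 1]
  simpa using integral_max_sub ht0 ht1

lemma integral_uncovered_sq_le {n : ℕ} {t : ℝ} (h0 : 0 ≤ t) (h1 : t ≤ 1) :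
    ∫ x : Fin n → UnitAddCircle, uncovered x t ^ 2 ≤
      (1 - t) ^ n * ((1 - t) ^ n + n * t ^ 2) := by
  have h1t : 0 ≤ 1 - t := sub_nonneg.2 h1
  set φ : ℝ → ℝ := fun r =>
    (1 - t) ^ n * ((1 - t) ^ n + n * (max (t - r) 0 + max (t - (1 - r)) 0)) with hφ
  have hφc : Continuous φ := by fun_prop
  have hφ0 : ∀ r, 0 ≤ φ r := fun r => by positivity
  have hφi : ∫ r in (0 : ℝ)..1, φ r = (1 - t) ^ n * ((1 - t) ^ n + n * t ^ 2) := by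
    have hc1 : Continuous fun r : ℝ => max (t - r) 0 := by fun_prop
    have hc2 : Continuous fun r : ℝ => max (t - (1 - r)) 0 := by fun_prop
    simp only [hφ]
    have hc3 : Continuous fun r : ℝ => n * (max (t - r) 0 + max (t - (1 - r)) 0) := by fun_prop
    rw [intervalIntegral.integral_const_mul, intervalIntegral.integral_add (by simp)
      (hc3.intervalIntegrable _ _),
      intervalIntegral.integral_const_mul,
      intervalIntegral.integral_add (hc1.intervalIntegrable _ _) (hc2.intervalIntegrable _ _),
      integral_max_sub h0 h1, integral_max_sub_one_sub h0 h1]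
    simp
  have hS : MeasurableSet {p : (UnitAddCircle × UnitAddCircle) × UnitAddCircle |
      t < forwardDist p.1.1 p.2 ∧ t < forwardDist p.1.2 p.2} :=
    (measurableSet_lt measurable_const (Measurable.forwardDist (by fun_prop) (by fun_prop))).inter
      (measurableSet_lt measurable_const (Measurable.forwardDist (by fun_prop) (by fun_prop)))
  have h := lintegral_volume_forall_mem (n := n)
    (volume : Measure (UnitAddCircle × UnitAddCircle)) hS
  have hprod : ∀ x : Fin n → UnitAddCircle, ENNReal.ofReal (uncovered x t ^ 2) =
      volume {a : UnitAddCircle × UnitAddCircle |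
        ∀ i, t < forwardDist a.1 (x i) ∧ t < forwardDist a.2 (x i)} := by
    intro x
    have : {a : UnitAddCircle × UnitAddCircle |
        ∀ i, t < forwardDist a.1 (x i) ∧ t < forwardDist a.2 (x i)} =
        {w | ∀ i, t < forwardDist w (x i)} ×ˢ {w | ∀ i, t < forwardDist w (x i)} := by
      ext a; simp [forall_and]
    rw [this, Measure.volume_eq_prod, Measure.prod_prod, ENNReal.ofReal_pow (uncovered_nonneg x t),
      ofReal_uncovered, sq]
  have hbound : ∫⁻ a : UnitAddCircle × UnitAddCircle,
      volume {y | t < forwardDist a.1 y ∧ t < forwardDist a.2 y} ^ n ≤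
      ENNReal.ofReal (∫ r in (0 : ℝ)..1, φ r) := by
    calc _ ≤ ∫⁻ a : UnitAddCircle × UnitAddCircle, ENNReal.ofReal (φ (forwardDist a.1 a.2)) := by
          refine lintegral_mono fun a => ?_
          refine (pow_le_pow_left₀ zero_le (volume_lt_forwardDist_and_le a.1 a.2 t) n).trans ?_
          rw [← ENNReal.ofReal_pow (by positivity)]
          exact ENNReal.ofReal_le_ofReal (overlap_pow_le h0 h1 (forwardDist_nonneg _ _)
            (forwardDist_lt_one _ _).le n)
      _ = ∫⁻ w : UnitAddCircle, ∫⁻ v : UnitAddCircle, ENNReal.ofReal (φ (forwardDist w v)) := by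
          rw [Measure.volume_eq_prod, lintegral_prod]
          exact (hφc.measurable.comp (Measurable.forwardDist measurable_fst
            measurable_snd)).ennreal_ofReal.aemeasurable
      _ = ∫⁻ w : UnitAddCircle, ∫⁻ r in Set.Ioo (0 : ℝ) 1, ENNReal.ofReal (φ r) :=
          lintegral_congr fun w => (measurePreserving_forwardDist_right w).lintegral_comp
            hφc.measurable.ennreal_ofReal
      _ = _ := by
          rw [lintegral_const, measure_univ, mul_one, intervalIntegral.integral_of_le zero_le_one,
            integral_Ioc_eq_integral_Ioo, ofReal_integral_eq_lintegral_ofReal]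
          · exact (hφc.integrableOn_Icc (a := 0) (b := 1)).mono_set Set.Ioo_subset_Icc_self
          · exact ae_of_all _ hφ0
  rw [← hφi]
  rw [integral_eq_lintegral_of_nonneg_ae (ae_of_all _ fun x => by positivity)
    ((measurable_uncovered_left t).pow_const 2).aestronglyMeasurable]
  refine ENNReal.toReal_le_of_le_ofReal
    (intervalIntegral.integral_nonneg zero_le_one fun r _ => hφ0 r) ?_
  simp only [hprod]
  exact h.trans_le hbound

lemma integral_sub_const_sq {α : Type*} [MeasurableSpace α] {μ : Measure α}
    [IsProbabilityMeasure μ] {X : α → ℝ} (hX : Integrable X μ)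
    (hX2 : Integrable (fun a => X a ^ 2) μ) (c : ℝ) :
    ∫ a, (X a - c) ^ 2 ∂μ = ∫ a, X a ^ 2 ∂μ - 2 * c * ∫ a, X a ∂μ + c ^ 2 := by
  have he : ∀ a, (X a - c) ^ 2 = (X a ^ 2 + -(2 * c) * X a) + c ^ 2 := fun a => by ring
  have h1 : Integrable (fun a => -(2 * c) * X a) μ := hX.const_mul _
  have h2 : Integrable (fun a => X a ^ 2 + -(2 * c) * X a) μ := hX2.add h1
  simp only [he]
  rw [integral_add h2 (integrable_const _), integral_add hX2 h1, integral_const_mul]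
  simp only [integral_const, probReal_univ, smul_eq_mul, one_mul]
  ring

lemma integral_abs_uncovered_sub_le {n : ℕ} {t : ℝ} (h0 : 0 ≤ t) (h1 : t ≤ 1) :
    ∫ x : Fin n → UnitAddCircle, |uncovered x t - (1 - t) ^ n| ≤
      √n * t * Real.exp (-(n * t / 2)) := by
  set g := (1 - t) ^ n with hg
  have hi1 : Integrable fun x : Fin n → UnitAddCircle => uncovered x t := by
    simpa using integrable_uncovered_pow (n := n) t 1
  have hi2 := integrable_uncovered_pow (n := n) t 2
  have hia : Integrable fun x : Fin n → UnitAddCircle => |uncovered x t - g| :=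
    (hi1.sub (integrable_const g)).abs
  have hvar : ∫ x : Fin n → UnitAddCircle, |uncovered x t - g| ^ 2 ≤ n * t ^ 2 * g := by
    simp only [sq_abs]
    rw [integral_sub_const_sq hi1 hi2, integral_uncovered h0 h1]
    have := integral_uncovered_sq_le (n := n) h0 h1
    rw [← hg] at this ⊢
    linarith
  set c := ∫ x : Fin n → UnitAddCircle, |uncovered x t - g| with hc
  have hcs : c ^ 2 ≤ ∫ x : Fin n → UnitAddCircle, |uncovered x t - g| ^ 2 := by
    have hi2' : Integrable fun x : Fin n → UnitAddCircle => |uncovered x t - g| ^ 2 := by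
      have he : ∀ x : Fin n → UnitAddCircle, |uncovered x t - g| ^ 2 =
          uncovered x t ^ 2 - 2 * g * uncovered x t + g ^ 2 := fun x => by rw [sq_abs]; ring
      simp only [he]
      exact (hi2.sub (hi1.const_mul _)).add (integrable_const _)
    -- Cauchy–Schwarz, in the form that the variance of |F-g| is nonnegative.
    have hnn : 0 ≤ ∫ x : Fin n → UnitAddCircle, (|uncovered x t - g| - c) ^ 2 :=
      integral_nonneg fun x => sq_nonneg _
    rw [integral_sub_const_sq hia hi2', ← hc] at hnn
    linarith
  have hgexp : g ≤ Real.exp (-(n * t / 2)) ^ 2 := by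
    rw [← Real.exp_nat_mul, hg]
    refine (pow_le_pow_left₀ (sub_nonneg.2 h1) (Real.one_sub_le_exp_neg t) n).trans_eq ?_
    rw [← Real.exp_nat_mul]
    congr 1
    push_cast
    ring
  refine abs_le_of_sq_le_sq' ?_ (by positivity) |>.2
  calc c ^ 2 ≤ n * t ^ 2 * g := hcs.trans hvar
    _ ≤ n * t ^ 2 * Real.exp (-(n * t / 2)) ^ 2 := by gcongr
    _ = _ := by rw [mul_pow, mul_pow, Real.sq_sqrt (Nat.cast_nonneg n)]

/-! ### Concentration of the peak load -/

lemma integral_mul_exp_neg_le {a : ℝ} (ha : 0 < a) :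
    ∫ t in (0 : ℝ)..1, t * Real.exp (-(a * t)) ≤ 1 / a ^ 2 := by
  have hderiv : ∀ t ∈ Set.uIcc (0 : ℝ) 1,
      HasDerivAt (fun t : ℝ => -(t / a + 1 / a ^ 2) * Real.exp (-(a * t)))
        (t * Real.exp (-(a * t))) t := by
    intro t _
    have h1 : HasDerivAt (fun t : ℝ => -(t / a + 1 / a ^ 2)) (-(1 / a)) t :=
      (((hasDerivAt_id t).div_const a).add_const _).neg
    have h2 : HasDerivAt (fun t : ℝ => Real.exp (-(a * t)))
        (Real.exp (-(a * t)) * -(a * 1)) t :=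
      ((hasDerivAt_id t).const_mul a).neg.exp
    have e : t * Real.exp (-(a * t)) = -(1 / a) * Real.exp (-(a * t)) +
        -(t / a + 1 / a ^ 2) * (Real.exp (-(a * t)) * -(a * 1)) := by
      field_simp
      ring
    rw [e]
    exact h1.mul h2
  have hc : Continuous fun t : ℝ => t * Real.exp (-(a * t)) := by fun_prop
  rw [intervalIntegral.integral_eq_sub_of_hasDerivAt hderiv (hc.intervalIntegrable _ _)]
  have : 0 ≤ (1 / a + 1 / a ^ 2) * Real.exp (-(a * 1)) := by positivity
  simp only [zero_div, mul_zero, neg_zero, Real.exp_zero]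
  linarith

lemma add_one_sq_le_two_pow (k : ℕ) : ((k : ℝ) + 1) ^ 2 ≤ 6 * 2 ^ k := by
  -- A stronger quadratic that at most doubles at each step, so that induction closes.
  have h : (k : ℝ) ^ 2 + 4 * k + 6 ≤ 6 * 2 ^ k := by
    induction k with
    | zero => norm_num
    | succ k ih =>
      have e : (6 : ℝ) * 2 ^ (k + 1) = 2 * (6 * 2 ^ k) := by ring
      rw [e]
      push_cast
      nlinarith [sq_nonneg (k : ℝ), (Nat.cast_nonneg k : (0 : ℝ) ≤ k)]
  nlinarith [(Nat.cast_nonneg k : (0 : ℝ) ≤ k)]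

/-- A weight that dominates the `k`-th power of the uncovered part. -/
noncomputable def weight (n k : ℕ) (t : ℝ) : ℝ :=
  Real.exp (-(k * (n * t / 4))) + (1 / 2) ^ k

/-- The weighted `L¹` distance on `[0, 1]` between the uncovered part and its mean. -/
noncomputable def deviation {n : ℕ} (k : ℕ) (x : Fin n → UnitAddCircle) : ℝ :=
  ∫ t in (0 : ℝ)..1, |uncovered x t - (1 - t) ^ n| * weight n k t

lemma continuous_weight (n k : ℕ) : Continuous (weight n k) := by
  unfold weight; fun_prop

lemma weight_nonneg (n k : ℕ) (t : ℝ) : 0 ≤ weight n k t := by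
  unfold weight; positivity

lemma weight_le_two (n k : ℕ) {t : ℝ} (ht : 0 ≤ t) : weight n k t ≤ 2 := by
  have h1 : Real.exp (-(k * (n * t / 4))) ≤ 1 := Real.exp_le_one_iff.2 (by
    have : 0 ≤ k * (n * t / 4) := by positivity
    linarith)
  have h2 : (1 / 2 : ℝ) ^ k ≤ 1 := pow_le_one₀ (by norm_num) (by norm_num)
  unfold weight
  linarith

lemma deviation_nonneg {n : ℕ} (k : ℕ) (x : Fin n → UnitAddCircle) : 0 ≤ deviation k x :=
  intervalIntegral.integral_nonneg zero_le_one fun t _ =>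
    mul_nonneg (abs_nonneg _) (weight_nonneg n k t)

lemma norm_deviation_integrand_le {n : ℕ} (k : ℕ) (x : Fin n → UnitAddCircle) {t : ℝ}
    (ht : t ∈ Set.Ioc (0 : ℝ) 1) : ‖|uncovered x t - (1 - t) ^ n| * weight n k t‖ ≤ 2 := by
  have h0 := uncovered_nonneg x t
  have h1 := uncovered_le_one x t
  have h2 : 0 ≤ (1 - t) ^ n := pow_nonneg (by linarith [ht.2]) n
  have h3 : (1 - t) ^ n ≤ 1 := pow_le_one₀ (by linarith [ht.2]) (by linarith [ht.1])
  have h4 : |uncovered x t - (1 - t) ^ n| ≤ 1 := abs_le.2 ⟨by linarith, by linarith⟩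
  rw [Real.norm_of_nonneg (mul_nonneg (abs_nonneg _) (weight_nonneg n k t))]
  nlinarith [weight_le_two n k ht.1.le, weight_nonneg n k t,
    abs_nonneg (uncovered x t - (1 - t) ^ n)]

lemma integrable_deviation_integrand (n k : ℕ) :
    Integrable (Function.uncurry fun (x : Fin n → UnitAddCircle) (t : ℝ) =>
      |uncovered x t - (1 - t) ^ n| * weight n k t)
      (volume.prod (volume.restrict (Set.Ioc (0 : ℝ) 1))) := by
  refine Integrable.of_bound ?_ 2 ?_
  · have h1 : Measurable fun p : (Fin n → UnitAddCircle) × ℝ => (1 - p.2) ^ n := by fun_prop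
    have h2 : Measurable fun p : (Fin n → UnitAddCircle) × ℝ => weight n k p.2 :=
      (continuous_weight n k).measurable.comp measurable_snd
    exact ((measurable_uncovered_uncurry.sub h1).abs.mul h2).aestronglyMeasurable
  · have h := Measure.quasiMeasurePreserving_snd
      (μ := (volume : Measure (Fin n → UnitAddCircle)))
      (ν := volume.restrict (Set.Ioc (0 : ℝ) 1)) |>.ae (ae_restrict_mem measurableSet_Ioc)
    filter_upwards [h] with p hp
    exact norm_deviation_integrand_le k p.1 hp

lemma integrable_deviation (n k : ℕ) :
    Integrable (deviation k : (Fin n → UnitAddCircle) → ℝ) := by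
  refine (integrable_deviation_integrand n k).integral_prod_left.congr (ae_of_all _ fun x => ?_)
  exact (intervalIntegral.integral_of_le zero_le_one).symm

/-- The first part of the weight gains 1/(k+1)² on integration and the second has 2^(-k), so the
factor (k+1)² is absorbed uniformly in k. The constant is 16 + 4·6. -/
lemma integral_deviation_le {n : ℕ} (hn : 0 < n) (k : ℕ) :
    n * ((k : ℝ) + 1) ^ 2 * ∫ x : Fin n → UnitAddCircle, deviation k x ≤ 40 / √n := by
  have hn' : (0 : ℝ) < n := by exact_mod_cast hn
  have hswap : ∫ x : Fin n → UnitAddCircle, deviation k x =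
      ∫ t in (0 : ℝ)..1, ∫ x : Fin n → UnitAddCircle,
        |uncovered x t - (1 - t) ^ n| * weight n k t := by
    simp only [deviation, intervalIntegral.integral_of_le (zero_le_one (α := ℝ))]
    exact integral_integral_swap (integrable_deviation_integrand n k)
  have hint : IntervalIntegrable (fun t => ∫ x : Fin n → UnitAddCircle,
        |uncovered x t - (1 - t) ^ n| * weight n k t) volume 0 1 :=
    (intervalIntegrable_iff_integrableOn_Ioc_of_le zero_le_one).2
      (integrable_deviation_integrand n k).integral_prod_right
  -- Of the decay exp(-nt/2) of the L¹ error only exp(-nt/4) is kept, to turn k into k+1.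
  set a : ℝ := (k + 1) * n / 4 with ha
  set b : ℝ := n / 2 with hb
  have hc1 : Continuous fun t : ℝ => t * Real.exp (-(a * t)) := by fun_prop
  have hc2 : Continuous fun t : ℝ => (1 / 2) ^ k * (t * Real.exp (-(b * t))) := by fun_prop
  have hc : Continuous fun t : ℝ =>
      √n * (t * Real.exp (-(a * t)) + (1 / 2) ^ k * (t * Real.exp (-(b * t)))) := by fun_prop
  have hle : ∀ t ∈ Set.Icc (0 : ℝ) 1, ∫ x : Fin n → UnitAddCircle,
        |uncovered x t - (1 - t) ^ n| * weight n k t ≤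
      √n * (t * Real.exp (-(a * t)) + (1 / 2) ^ k * (t * Real.exp (-(b * t)))) := by
    intro t ht
    rw [integral_mul_const]
    refine (mul_le_mul_of_nonneg_right (integral_abs_uncovered_sub_le ht.1 ht.2)
      (weight_nonneg n k t)).trans ?_
    have he : Real.exp (-(n * t / 2)) * Real.exp (-(k * (n * t / 4))) ≤ Real.exp (-(a * t)) := by
      rw [← Real.exp_add]
      refine Real.exp_le_exp.2 ?_
      have : 0 ≤ n * t := mul_nonneg hn'.le ht.1
      rw [ha]
      linarith
    have he2 : Real.exp (-(n * t / 2)) = Real.exp (-(b * t)) := by rw [hb]; ring_nf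
    have h3 : 0 ≤ √n * t := mul_nonneg (Real.sqrt_nonneg _) ht.1
    calc √n * t * Real.exp (-(n * t / 2)) * weight n k t
        = √n * t * (Real.exp (-(n * t / 2)) * Real.exp (-(k * (n * t / 4))) +
            (1 / 2) ^ k * Real.exp (-(n * t / 2))) := by unfold weight; ring
      _ ≤ √n * t * (Real.exp (-(a * t)) + (1 / 2) ^ k * Real.exp (-(b * t))) := by
          rw [he2] at he ⊢
          exact mul_le_mul_of_nonneg_left (by linarith) h3
      _ = _ := by ring
  have hmain : ∫ x : Fin n → UnitAddCircle, deviation k x ≤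
      √n * (1 / a ^ 2 + (1 / 2) ^ k * (1 / b ^ 2)) := by
    rw [hswap]
    refine (intervalIntegral.integral_mono_on zero_le_one hint
      (hc.intervalIntegrable _ _) hle).trans ?_
    rw [intervalIntegral.integral_const_mul, intervalIntegral.integral_add
      (hc1.intervalIntegrable _ _) (hc2.intervalIntegrable _ _),
      intervalIntegral.integral_const_mul]
    have h1 := integral_mul_exp_neg_le (a := a) (by positivity)
    have h2 := integral_mul_exp_neg_le (a := b) (by positivity)
    gcongr
  refine (mul_le_mul_of_nonneg_left hmain (by positivity)).trans ?_
  have hk := add_one_sq_le_two_pow k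
  have hs : √(n : ℝ) * √n = n := Real.mul_self_sqrt hn'.le
  have hs0 : 0 < √(n : ℝ) := Real.sqrt_pos.2 hn'
  have h2k : (1 / 2 : ℝ) ^ k * ((k : ℝ) + 1) ^ 2 ≤ 6 := by
    rw [one_div, inv_pow, inv_mul_le_iff₀ (by positivity)]
    linarith
  have e : n * ((k : ℝ) + 1) ^ 2 * (√n * (1 / a ^ 2 + (1 / 2) ^ k * (1 / b ^ 2))) =
      (16 + 4 * ((1 / 2) ^ k * ((k : ℝ) + 1) ^ 2)) * (√n / n) := by
    rw [ha, hb]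
    field_simp
    ring
  have e2 : √(n : ℝ) / n = 1 / √n := by
    rw [div_eq_div_iff hn'.ne' hs0.ne', hs, one_mul]
  rw [e, e2, mul_one_div]
  gcongr
  linarith

lemma uncovered_pow_le_weight {n : ℕ} (hn : 0 < n) (k : ℕ) (x : Fin n → UnitAddCircle)
    (hx : uncovered x (1 / n) ≤ 1 / 2) {t : ℝ} (ht : 0 ≤ t) :
    uncovered x t ^ k ≤ weight n k t := by
  unfold weight
  rcases le_total t (1 / n) with h | h
  · have h1 := pow_le_pow_left₀ (uncovered_nonneg x t) (uncovered_le_exp hn x hx ht h) k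
    rw [← Real.exp_nat_mul, mul_neg] at h1
    have : (0 : ℝ) ≤ (1 / 2) ^ k := by positivity
    linarith
  · have h1 := pow_le_pow_left₀ (uncovered_nonneg x t) ((uncovered_antitone x h).trans hx) k
    linarith [Real.exp_pos (-(k * (n * t / 4)))]

lemma one_sub_pow_pow_le_weight (n k : ℕ) {t : ℝ} (ht : 0 ≤ t) (ht1 : t ≤ 1) :
    ((1 - t) ^ n) ^ k ≤ weight n k t := by
  have h1 : (1 - t) ^ n ≤ Real.exp (-(n * t / 4)) := by
    refine (pow_le_pow_left₀ (sub_nonneg.2 ht1) (Real.one_sub_le_exp_neg t) n).trans ?_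
    rw [← Real.exp_nat_mul]
    refine Real.exp_le_exp.2 ?_
    have : 0 ≤ n * t := by positivity
    linarith
  have h2 := pow_le_pow_left₀ (pow_nonneg (sub_nonneg.2 ht1) n) h1 k
  rw [← Real.exp_nat_mul, mul_neg] at h2
  have : (0 : ℝ) ≤ (1 / 2) ^ k := by positivity
  unfold weight
  linarith

lemma intervalIntegrable_deviation_integrand {n : ℕ} (k : ℕ) (x : Fin n → UnitAddCircle) :
    IntervalIntegrable (fun t => |uncovered x t - (1 - t) ^ n| * weight n k t) volume 0 1 := by
  rw [intervalIntegrable_iff_integrableOn_Ioc_of_le zero_le_one]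
  refine Integrable.of_bound ?_ 2
    ((ae_restrict_mem measurableSet_Ioc).mono fun t ht => norm_deviation_integrand_le k x ht)
  have h1 : Measurable fun t : ℝ => (1 - t) ^ n := by fun_prop
  exact (((measurable_uncovered x).sub h1).abs.mul
    (continuous_weight n k).measurable).aestronglyMeasurable

lemma intervalIntegrable_uncovered_pow {n : ℕ} (k : ℕ) (x : Fin n → UnitAddCircle) :
    IntervalIntegrable (fun t => uncovered x t ^ k) volume 0 1 := by
  rw [intervalIntegrable_iff_integrableOn_Ioc_of_le zero_le_one]
  refine Integrable.of_bound ((measurable_uncovered x).pow_const k).aestronglyMeasurable 1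
    (ae_of_all _ fun t => ?_)
  rw [Real.norm_of_nonneg (pow_nonneg (uncovered_nonneg x t) k)]
  exact pow_le_one₀ (uncovered_nonneg x t) (uncovered_le_one x t)

lemma integral_one_sub_pow (N : ℕ) : ∫ t in (0 : ℝ)..1, (1 - t) ^ N = 1 / (N + 1) := by
  rw [intervalIntegral.integral_comp_sub_left (fun t => t ^ N) 1]
  simp [integral_pow]

/-! ### From the deviation of the uncovered part to that of the peak load. -/

lemma abs_integral_uncovered_pow_sub_le {n : ℕ} (hn : 0 < n) (k : ℕ) (x : Fin n → UnitAddCircle)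
    (hx : uncovered x (1 / n) ≤ 1 / 2) :
    |(∫ t in (0 : ℝ)..1, uncovered x t ^ (k + 1)) - 1 / (n * (k + 1) + 1)| ≤
      (k + 1) * deviation k x := by
  have hg : ∫ t in (0 : ℝ)..1, ((1 - t) ^ n) ^ (k + 1) = 1 / ((n : ℝ) * (k + 1) + 1) := by
    simp only [← pow_mul]
    rw [integral_one_sub_pow]
    push_cast
    rfl
  have hgc : Continuous fun t : ℝ => ((1 - t) ^ n) ^ (k + 1) := by fun_prop
  rw [← hg, ← intervalIntegral.integral_sub (intervalIntegrable_uncovered_pow (k + 1) x)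
    (hgc.intervalIntegrable _ _), deviation, ← intervalIntegral.integral_const_mul,
    ← Real.norm_eq_abs]
  refine intervalIntegral.norm_integral_le_of_norm_le zero_le_one (ae_of_all _ fun t ht => ?_)
    ((intervalIntegrable_deviation_integrand k x).const_mul _)
  have hp : 0 ≤ (1 - t) ^ n := pow_nonneg (sub_nonneg.2 ht.2) n
  have h := abs_pow_sub_pow_le (uncovered x t) ((1 - t) ^ n) (k + 1)
  rw [abs_of_nonneg (uncovered_nonneg x t), abs_of_nonneg hp, Nat.add_sub_cancel] at h
  have hmax : max (uncovered x t) ((1 - t) ^ n) ^ k ≤ weight n k t := by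
    rcases max_choice (uncovered x t) ((1 - t) ^ n) with e | e <;> rw [e]
    · exact uncovered_pow_le_weight hn k x hx ht.1.le
    · exact one_sub_pow_pow_le_weight n k ht.1.le ht.2
  refine h.trans ?_
  push_cast
  calc |uncovered x t - (1 - t) ^ n| * (k + 1) * max (uncovered x t) ((1 - t) ^ n) ^ k
      ≤ |uncovered x t - (1 - t) ^ n| * (k + 1) * weight n k t := by gcongr
    _ = _ := by ring

lemma abs_mul_peakLoad_sub_le {n : ℕ} (hn : 0 < n) (k : ℕ) (x : Fin n → UnitAddCircle)
    (hx : uncovered x (1 / n) ≤ 1 / 2) :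
    |n * peakLoad (k + 2) x - ((k : ℝ) + 2) / (k + 1)| ≤
      2 * (n * ((k : ℝ) + 1) ^ 2 * deviation k x) + 2 / n := by
  have hn' : (0 : ℝ) < n := by exact_mod_cast hn
  have h := abs_integral_uncovered_pow_sub_le hn k x hx
  have hd := deviation_nonneg k x
  rw [show k + 2 = k + 1 + 1 from rfl, peakLoad_eq hn k.succ_pos]
  set I := ∫ t in (0 : ℝ)..1, uncovered x t ^ (k + 1)
  set D := deviation k x
  push_cast
  have hk : (0 : ℝ) ≤ k := Nat.cast_nonneg k
  have e : (n : ℝ) * ((k + 1 + 1) * I) - (k + 2) / (k + 1) =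
      n * (k + 2) * (I - 1 / (n * (k + 1) + 1)) - (k + 2) / ((k + 1) * (n * (k + 1) + 1)) := by
    field_simp
    ring
  rw [e]
  refine (abs_sub _ _).trans (add_le_add ?_ ?_)
  · rw [abs_mul, abs_of_nonneg (by positivity : 0 ≤ (n : ℝ) * (k + 2))]
    calc (n : ℝ) * (k + 2) * |I - 1 / (n * (k + 1) + 1)|
        ≤ n * (2 * (k + 1)) * ((k + 1) * D) := by
          gcongr
          linarith
      _ = _ := by ring
  · rw [abs_of_nonneg (by positivity), div_le_div_iff₀ (by positivity) hn']
    nlinarith [mul_nonneg hk hn'.le, mul_nonneg hk hk, mul_nonneg (mul_nonneg hk hk) hn'.le]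

/-- Outside an event of probability at most `50 n ^ (-1/4)` the peak load is near its limit. -/
lemma exists_measurableSet_peakLoad {n : ℕ} (hn : 0 < n) (k : ℕ) :
    ∃ B : Set (Fin n → UnitAddCircle), MeasurableSet B ∧
      volume.real B ≤ 50 * (n : ℝ) ^ (-(1 / 4) : ℝ) ∧
      ∀ x ∉ B, |n * peakLoad (k + 2) x - ((k : ℝ) + 2) / (k + 1)| ≤
        4 * (n : ℝ) ^ (-(1 / 4) : ℝ) := by
  have hn' : (0 : ℝ) < n := by exact_mod_cast hn
  have hn1 : (1 : ℝ) ≤ n := by exact_mod_cast hn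
  -- The square root of the mean error scale n^(-1/2): Markov at threshold δ leaves probability of
  -- order δ as well.
  set δ : ℝ := (n : ℝ) ^ (-(1 / 4) : ℝ) with hδ
  have hδ0 : 0 < δ := Real.rpow_pos_of_pos hn' _
  have hδ2 : δ * δ = 1 / √n := by
    rw [hδ, ← Real.rpow_add hn', Real.sqrt_eq_rpow, one_div (_ ^ _), ← Real.rpow_neg hn'.le]
    norm_num
  have hδ1 : δ ≤ 1 := Real.rpow_le_one_of_one_le_of_nonpos hn1 (by norm_num)
  have hδn : 1 / (n : ℝ) ≤ δ := by
    rw [one_div, ← Real.rpow_neg_one]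
    exact Real.rpow_le_rpow_of_exponent_le hn1 (by norm_num)
  set R : (Fin n → UnitAddCircle) → ℝ := fun x => n * ((k : ℝ) + 1) ^ 2 * deviation k x
  set E : (Fin n → UnitAddCircle) → ℝ := fun x => |uncovered x (1 / n) - (1 - 1 / n) ^ n|
  have hRi : Integrable R := (integrable_deviation n k).const_mul _
  have hEi : Integrable E := by
    have h := integrable_uncovered_pow (n := n) (1 / n) 1
    simp only [pow_one] at h
    exact (h.sub (integrable_const _)).abs
  have hR0 : ∀ x, 0 ≤ R x := fun x => mul_nonneg (by positivity) (deviation_nonneg k x)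
  have hR := mul_meas_ge_le_integral_of_nonneg (ae_of_all _ hR0) hRi δ
  have hE := mul_meas_ge_le_integral_of_nonneg (ae_of_all _ fun x => abs_nonneg _) hEi (1 / 10)
  have hRint : ∫ x, R x ≤ 40 / √n := by
    simp only [R]
    rw [integral_const_mul]
    exact integral_deviation_le hn k
  have hEint : ∫ x, E x ≤ 1 / √n := by
    refine (integral_abs_uncovered_sub_le (by positivity) ?_).trans ?_
    · rw [div_le_one hn']; exact hn1
    · have h1 : Real.exp (-((n : ℝ) * (1 / n) / 2)) ≤ 1 :=
        Real.exp_le_one_iff.2 (neg_nonpos.2 (by positivity))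
      have h2 : √(n : ℝ) * (1 / n) = 1 / √n := by
        rw [mul_one_div, div_eq_div_iff hn'.ne' (Real.sqrt_pos.2 hn').ne',
          Real.mul_self_sqrt hn'.le, one_mul]
      rw [h2]
      exact mul_le_of_le_one_right (by positivity) h1
  have hB : {x | δ ≤ R x ∨ 1 / 10 ≤ E x} = {x | δ ≤ R x} ∪ {x | 1 / 10 ≤ E x} := rfl
  -- A measurable hull has the same measure, and its preimage under the node hashes is measurable.
  refine ⟨toMeasurable volume {x | δ ≤ R x ∨ 1 / 10 ≤ E x}, measurableSet_toMeasurable _ _,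
    ?_, fun x hx => ?_⟩
  · rw [measureReal_def, measure_toMeasurable, ← measureReal_def, hB]
    refine (measureReal_union_le _ _).trans ?_
    have h1 : volume.real {x | δ ≤ R x} ≤ 40 * δ := by
      refine le_of_mul_le_mul_left ?_ hδ0
      calc δ * volume.real {x | δ ≤ R x} ≤ 40 / √n := hR.trans hRint
        _ = δ * (40 * δ) := by rw [mul_left_comm, hδ2, mul_one_div]
    have h2 : volume.real {x | 1 / 10 ≤ E x} ≤ 10 * δ := by
      have := hE.trans hEint
      rw [← hδ2] at this
      nlinarith
    linarith
  · have hx' : ¬ (δ ≤ R x ∨ 1 / 10 ≤ E x) := fun h => hx (subset_toMeasurable _ _ h)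
    push Not at hx'
    have hg : (1 - 1 / (n : ℝ)) ^ n ≤ 0.37 := by
      have h1 : (1 - 1 / (n : ℝ)) ^ n ≤ Real.exp (-1) := by
        refine (pow_le_pow_left₀ ?_ (Real.one_sub_le_exp_neg (1 / (n : ℝ))) n).trans_eq ?_
        · rw [sub_nonneg, div_le_one hn']; exact hn1
        · rw [← Real.exp_nat_mul]; field_simp
      linarith [Real.exp_neg_one_lt_d9]
    -- The mean (1-1/n)^n ≤ 1/e < 0.37 leaves room for the deviation 1/10.
    have hhalf : uncovered x (1 / n) ≤ 1 / 2 := by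
      have := (le_abs_self _).trans_lt hx'.2
      norm_num at hg this ⊢
      linarith
    refine (abs_mul_peakLoad_sub_le hn k x hhalf).trans ?_
    have h2n : 2 / (n : ℝ) = 2 * (1 / n) := by ring
    linarith [hx'.1.le]

lemma IsRandomNodeHash.map_eq_volume {Ω : Type*} [MeasurableSpace Ω] {P : Measure Ω}
    [IsProbabilityMeasure P] {n : ℕ} {h : Fin n → Ω → UnitAddCircle}
    (hh : IsRandomNodeHash P h) : P.map (fun ω i => h i ω) = volume := by
  rw [hh.indep.map_fun_eq_pi_map fun i => (hh.measurable i).aemeasurable]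
  simp only [hh.uniform]
  rfl

end MultiProbe

open MeasureTheory Filter Asymptotics Topology in
theorem mainTheorem1 :
    ∃ c : ℝ, 0 < c ∧
      ∀ K : ℕ → ℕ, (∀ᶠ n in atTop, 2 ≤ K n) →
        (fun n : ℕ => (K n : ℝ)) =o[atTop] (fun n : ℕ => √(n : ℝ) / Real.log n) →
        ∃ ε : ℕ → ℝ, Tendsto ε atTop (𝓝 0) ∧
          ∀ᶠ n : ℕ in atTop,
            ∀ (Ω : Type*) [MeasurableSpace Ω] (P : Measure Ω) [IsProbabilityMeasure P]
              (h : Fin n → Ω → UnitAddCircle), MultiProbe.IsRandomNodeHash P h →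
              1 - (n : ℝ) ^ (-c) ≤ P.real {ω |
                |MultiProbe.peakLoad (K n) (fun i => h i ω)
                    - (K n : ℝ) / ((K n : ℝ) - 1) * (1 / (n : ℝ))| ≤ ε n * (1 / (n : ℝ)) ∧
                |MultiProbe.peakLoad (K n) (fun i => h i ω)
                    / MultiProbe.averageLoad (K n) (fun i => h i ω)
                    - (K n : ℝ) / ((K n : ℝ) - 1)| ≤ ε n} := by
  -- Any exponent below 1/4 would do for `c`: the slack absorbs the constant 50 for large n.
  refine ⟨1 / 8, by norm_num, fun K hK _ => ⟨fun n => 4 * (n : ℝ) ^ (-(1 / 4) : ℝ), ?_, ?_⟩⟩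
  · simpa using ((tendsto_rpow_neg_atTop (by norm_num : (0 : ℝ) < 1 / 4)).comp
      tendsto_natCast_atTop_atTop).const_mul 4
  have hlarge : ∀ᶠ n : ℕ in atTop, (50 : ℝ) ≤ (n : ℝ) ^ (1 / 8 : ℝ) :=
    ((tendsto_rpow_atTop (by norm_num : (0 : ℝ) < 1 / 8)).comp
      tendsto_natCast_atTop_atTop).eventually_ge_atTop 50
  filter_upwards [hK, hlarge, eventually_gt_atTop 0] with n hKn hn50 hn Ω _ P _ h hh
  have hn' : (0 : ℝ) < n := by exact_mod_cast hn
  obtain ⟨k, hk⟩ : ∃ k, K n = k + 2 := ⟨K n - 2, by omega⟩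
  obtain ⟨B, hBm, hB, hgood⟩ := MultiProbe.exists_measurableSet_peakLoad hn k
  have hmeas : Measurable fun ω i => h i ω := measurable_pi_lambda _ hh.measurable
  have hPB : P.real ((fun ω i => h i ω) ⁻¹' B) = volume.real B := by
    rw [measureReal_def, measureReal_def, ← hh.map_eq_volume, Measure.map_apply hmeas hBm]
  have hbound : 50 * (n : ℝ) ^ (-(1 / 4) : ℝ) ≤ (n : ℝ) ^ (-(1 / 8) : ℝ) := by
    calc 50 * (n : ℝ) ^ (-(1 / 4) : ℝ)
        ≤ (n : ℝ) ^ (1 / 8 : ℝ) * (n : ℝ) ^ (-(1 / 4) : ℝ) := by gcongr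
      _ = _ := by rw [← Real.rpow_add hn']; norm_num
  have hcompl := probReal_compl_eq_one_sub (μ := P) (hBm.preimage hmeas)
  rw [hPB] at hcompl
  refine (show 1 - (n : ℝ) ^ (-(1 / 8) : ℝ) ≤ _ by linarith).trans
    (hcompl.ge.trans (measureReal_mono fun ω hω => ?_))
  have hd := hgood (fun i => h i ω) hω
  have hKr : (K n : ℝ) / ((K n : ℝ) - 1) = ((k : ℝ) + 2) / (k + 1) := by
    rw [hk]; push_cast; congr 1; ring
  rw [Set.mem_ofPred_eq, hKr, hk, MultiProbe.averageLoad_eq hn (by omega)]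
  refine ⟨?_, ?_⟩
  · have e : MultiProbe.peakLoad (k + 2) (fun i => h i ω) - ((k : ℝ) + 2) / (k + 1) * (1 / n) =
        (n * MultiProbe.peakLoad (k + 2) (fun i => h i ω) - ((k : ℝ) + 2) / (k + 1)) * (1 / n) := by
      field_simp
    rw [e, abs_mul, abs_of_pos (by positivity : (0 : ℝ) < 1 / n)]
    gcongr
  · rwa [div_div_eq_mul_div, div_one, mul_comm]
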